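/- A group $G$ is called poly-free if it admits a finite chain of subgroups $1=G_0\unlhd G_1\unlhd\cdots\unlhd G_n=G$ such that each quotient $G_i/G_{i-1}$ is a free group of possibly infinite rank (the trivial group is free of rank $0$); it is called normally poly-free if such a chain can be chosen with every $G_i$ normal in $G$. The minimal such $n$ is the poly-free (resp. normally poly-free) length of $G$. A group is virtually poly-free (resp. virtually normally poly-free) if it has a subgroup of finite index that is poly-free (resp. normally poly-free). Let $(G_i)_{i\in I}$ be a family of groups indexed by an arbitrary set $I$, and let $\ast_{i\in I}G_i$ be its free product. 1. For every $n\ge 0$: if each $G_i$ is poly-free of length at most $n$, then $\ast_{i\in I}G_i$ is poly-free of length at most $n$. 2. For every $n\ge 0$: if each $G_i$ is normally poly-free of normally poly-free length at most $n$, then $\ast_{i\in I}G_i$ is normally poly-free of normally poly-free length at most $n$. 3. If $I$ is finite and each $G_i$ is virtually poly-free, then $\ast_{i\in I}G_i$ is virtually poly-free. 4. If $I$ is finite and each $G_i$ is virtually normally poly-free, then $\ast_{i\in I}G_i$ is virtually normally poly-free. -/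

import Mathlib

/-- A chain of subgroups `1 = H 0 ⊴ H 1 ⊴ ⋯ ⊴ H n = G` such that each successive quotient
`H (i+1) / H i` is a free group, of arbitrary (possibly zero, possibly infinite) rank. -/
def IsPolyFreeChain {G : Type*} [Group G] {n : ℕ} (H : Fin (n + 1) → Subgroup G) : Prop :=
  H 0 = ⊥ ∧ H (Fin.last n) = ⊤ ∧
    ∀ i : Fin n, H i.castSucc ≤ H i.succ ∧
      ∃ _ : ((H i.castSucc).subgroupOf (H i.succ)).Normal,
        IsFreeGroup (↥(H i.succ) ⧸ (H i.castSucc).subgroupOf (H i.succ))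

/-- `G` admits a poly-free chain with `n` steps. -/
def HasPolyFreeChain (G : Type*) [Group G] (n : ℕ) : Prop :=
  ∃ H : Fin (n + 1) → Subgroup G, IsPolyFreeChain H

/-- `G` admits a poly-free chain with `n` steps all of whose terms are normal in `G`. -/
def HasNormalPolyFreeChain (G : Type*) [Group G] (n : ℕ) : Prop :=
  ∃ H : Fin (n + 1) → Subgroup G, IsPolyFreeChain H ∧ ∀ i, (H i).Normal

/-- Poly-free groups. -/
def IsPolyFree (G : Type*) [Group G] : Prop :=
  ∃ n, HasPolyFreeChain G n

/-- Normally poly-free groups. -/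
def IsNormallyPolyFree (G : Type*) [Group G] : Prop :=
  ∃ n, HasNormalPolyFreeChain G n

/-- The poly-free length of `G`: the minimal number of steps of a poly-free chain
(meaningful for poly-free groups only). -/
noncomputable def polyFreeLength (G : Type*) [Group G] : ℕ :=
  sInf {n | HasPolyFreeChain G n}

/-- The normally poly-free length of `G`: the minimal number of steps of a poly-free chain
of normal subgroups (meaningful for normally poly-free groups only). -/
noncomputable def normallyPolyFreeLength (G : Type*) [Group G] : ℕ :=
  sInf {n | HasNormalPolyFreeChain G n}

/-- `G` has a poly-free subgroup of finite index. -/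
def IsVirtuallyPolyFree (G : Type*) [Group G] : Prop :=
  ∃ K : Subgroup G, K.FiniteIndex ∧ IsPolyFree K

/-- `G` has a normally poly-free subgroup of finite index. -/
def IsVirtuallyNormallyPolyFree (G : Type*) [Group G] : Prop :=
  ∃ K : Subgroup G, K.FiniteIndex ∧ IsNormallyPolyFree K

-- The engine is a weak form of Kurosh's theorem, `CoprodI.exists_injective_ker_lift`: the kernel of
-- a homomorphism `∗ G i → X` embeds in the free product of the kernels on the factors and a free
-- group. An embedding is enough, because subgroups of free groups are free and so chains pull back
-- along injections.
--
-- Poly-free length goes by induction: if `N i` is the penultimate term of a chain in `G i`, then `∗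
-- G i` maps to the free group `∗ (G i ⧸ N i)`, and the kernel embeds in a free product of groups
-- with shorter chains. For normal chains, the kernels of `∗ G i → ∗ (G i ⧸ C i k)` form a chain,
-- with quotients free by the same embedding. In the virtual case, the map goes to the finite group
-- `∏ G i ⧸ N i`.

universe u v w

/-! ### Free quotients and operations on chains -/

section FreeQuotients

variable {G : Type*} [Group G] {H : Type*} [Group H]

/-- A group that embeds in a free group is free. -/
theorem IsFreeGroup.of_injective [IsFreeGroup H] (f : G →* H) (hf : Function.Injective f) :
    IsFreeGroup G :=
  IsFreeGroup.ofMulEquiv (MonoidHom.ofInjective hf).symm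

/-- `A` is contained in `B`, normal in it, and the quotient is a free group. -/
def HasFreeQuotient (A B : Subgroup G) : Prop :=
  A ≤ B ∧ ∃ _ : (A.subgroupOf B).Normal, IsFreeGroup (↥B ⧸ A.subgroupOf B)

/-- Surjectivity is not needed: the quotient embeds in `F`, so it is free by Nielsen–Schreier. -/
theorem HasFreeQuotient.of_hom {A B : Subgroup G} (h : A ≤ B) {F : Type*} [Group F]
    [IsFreeGroup F] (g : B →* F) (hg : ∀ b : B, g b = 1 ↔ (b : G) ∈ A) : HasFreeQuotient A B := by
  have hk : A.subgroupOf B = g.ker := by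
    ext b
    rw [Subgroup.mem_subgroupOf, MonoidHom.mem_ker, hg]
  refine ⟨h, ?_⟩
  rw [hk]
  exact ⟨inferInstance, IsFreeGroup.of_injective _ (QuotientGroup.kerLift_injective g)⟩

theorem HasFreeQuotient.refl (A : Subgroup G) : HasFreeQuotient A A :=
  HasFreeQuotient.of_hom le_rfl (1 : A →* FreeGroup Empty) fun b => by simp

theorem HasFreeQuotient.comap {A B : Subgroup H} (h : HasFreeQuotient A B) (f : G →* H) :
    HasFreeQuotient (A.comap f) (B.comap f) := by
  obtain ⟨hle, hn, hF⟩ := h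
  refine HasFreeQuotient.of_hom (Subgroup.comap_mono hle)
    ((QuotientGroup.mk' (A.subgroupOf B)).comp (f.subgroupComap B)) fun b => ?_
  rw [MonoidHom.comp_apply, QuotientGroup.mk'_apply, QuotientGroup.eq_one_iff,
    Subgroup.mem_subgroupOf]
  rfl

theorem HasFreeQuotient.map {A B : Subgroup G} (h : HasFreeQuotient A B) (f : G →* H)
    (hf : Function.Injective f) : HasFreeQuotient (A.map f) (B.map f) := by
  obtain ⟨hle, hn, hF⟩ := h
  let e := B.equivMapOfInjective f hf
  refine HasFreeQuotient.of_hom (Subgroup.map_mono hle)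
    ((QuotientGroup.mk' (A.subgroupOf B)).comp e.symm.toMonoidHom) fun b => ?_
  obtain ⟨c, rfl⟩ := e.surjective b
  rw [MonoidHom.comp_apply, QuotientGroup.mk'_apply, QuotientGroup.eq_one_iff,
    Subgroup.mem_subgroupOf]
  simp [e, Subgroup.mem_map_iff_mem hf]

theorem IsPolyFreeChain.comap {n : ℕ} {C : Fin (n + 1) → Subgroup H} (hC : IsPolyFreeChain C)
    (f : G →* H) (hf : Function.Injective f) : IsPolyFreeChain fun i => (C i).comap f := by
  refine ⟨?_, ?_, fun i => (show HasFreeQuotient _ _ from hC.2.2 i).comap f⟩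
  · simp only [hC.1]
    exact f.ker_eq_bot_iff.2 hf
  · simp only [hC.2.1, Subgroup.comap_top]

theorem HasPolyFreeChain.of_injective {n : ℕ} (h : HasPolyFreeChain H n) (f : G →* H)
    (hf : Function.Injective f) : HasPolyFreeChain G n :=
  let ⟨_, hC⟩ := h
  ⟨_, hC.comap f hf⟩

theorem HasNormalPolyFreeChain.of_injective {n : ℕ} (h : HasNormalPolyFreeChain H n) (f : G →* H)
    (hf : Function.Injective f) : HasNormalPolyFreeChain G n :=
  let ⟨_, hC, hN⟩ := h
  ⟨_, hC.comap f hf, fun i => (hN i).comap f⟩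

/-- The top term is repeated; the added quotients are trivial, hence free of rank 0. -/
theorem IsPolyFreeChain.pad {n m : ℕ} {C : Fin (n + 1) → Subgroup G} (hC : IsPolyFreeChain C)
    (hnm : n ≤ m) :
    IsPolyFreeChain fun i : Fin (m + 1) => C ⟨min i n, by omega⟩ := by
  refine ⟨by simpa using hC.1, ?_, fun i => ?_⟩
  · simp only [Fin.val_last, min_eq_right hnm]
    exact hC.2.1
  · change HasFreeQuotient _ _
    obtain hi | hi := lt_or_ge i.1 n
    · have := hC.2.2 ⟨i, hi⟩
      simp only [Fin.val_castSucc, Fin.val_succ, min_eq_left hi.le,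
        min_eq_left (Nat.succ_le_of_lt hi)]
      exact this
    · simp only [Fin.val_castSucc, Fin.val_succ, min_eq_right hi,
        min_eq_right (hi.trans (Nat.le_succ _))]
      exact HasFreeQuotient.refl _

theorem HasPolyFreeChain.mono {n m : ℕ} (h : HasPolyFreeChain G n) (hnm : n ≤ m) :
    HasPolyFreeChain G m :=
  let ⟨_, hC⟩ := h
  ⟨_, hC.pad hnm⟩

theorem HasNormalPolyFreeChain.mono {n m : ℕ} (h : HasNormalPolyFreeChain G n) (hnm : n ≤ m) :
    HasNormalPolyFreeChain G m :=
  let ⟨_, hC, hN⟩ := h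
  ⟨_, hC.pad hnm, fun _ => hN _⟩

theorem HasNormalPolyFreeChain.hasPolyFreeChain {n : ℕ} (h : HasNormalPolyFreeChain G n) :
    HasPolyFreeChain G n :=
  let ⟨C, hC, _⟩ := h
  ⟨C, hC⟩

theorem hasPolyFreeChain_zero_iff : HasPolyFreeChain G 0 ↔ Subsingleton G := by
  constructor
  · rintro ⟨C, h0, h1, -⟩
    exact Subgroup.subsingleton_iff.1 (subsingleton_of_bot_eq_top (h0.symm.trans h1))
  · intro h
    exact ⟨fun _ => ⊥, rfl, Subsingleton.elim _ _, fun i => i.elim0⟩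

theorem IsFreeGroup.hasNormalPolyFreeChain_one [IsFreeGroup G] : HasNormalPolyFreeChain G 1 := by
  refine ⟨![⊥, ⊤], ⟨rfl, rfl, fun i => ?_⟩, fun i => ?_⟩
  · change HasFreeQuotient _ _
    fin_cases i
    exact HasFreeQuotient.of_hom bot_le (⊤ : Subgroup G).subtype fun b => Subgroup.mem_bot.symm
  · fin_cases i
    · exact Subgroup.normal_bot
    · exact Subgroup.normal_top

theorem HasPolyFreeChain.exists_normal {n : ℕ} (h : HasPolyFreeChain G (n + 1)) :
    ∃ (N : Subgroup G) (_ : N.Normal), IsFreeGroup (G ⧸ N) ∧ HasPolyFreeChain N n := by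
  obtain ⟨C, h0, h1, hC⟩ := h
  have hlast := hC (Fin.last n)
  rw [Fin.succ_last, h1] at hlast
  obtain ⟨-, hn, hF⟩ := hlast
  set N := C (Fin.last n).castSucc
  have hN : N.Normal := by
    refine ⟨fun a ha g => ?_⟩
    exact hn.conj_mem ⟨a, Subgroup.mem_top a⟩ ha ⟨g, Subgroup.mem_top g⟩
  refine ⟨N, hN, ?_, fun i => (C i.castSucc).comap N.subtype, ?_, ?_, fun i => ?_⟩
  · let g : G →* (⊤ : Subgroup G) ⧸ N.subgroupOf ⊤ :=
      (QuotientGroup.mk' _).comp Subgroup.topEquiv.symm.toMonoidHom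
    have hg : g.ker = N := by
      ext x
      simp only [g, MonoidHom.mem_ker, MonoidHom.comp_apply, QuotientGroup.mk'_apply,
        QuotientGroup.eq_one_iff, Subgroup.mem_subgroupOf]
      rfl
    refine IsFreeGroup.of_injective (QuotientGroup.lift N g fun x hx => by rwa [← hg] at hx) ?_
    exact (QuotientGroup.injective_lift_iff _ _ _).2 hg.symm
  · simp [h0]
  · simp [N]
  · exact (show HasFreeQuotient _ _ from hC i.castSucc).comap _

theorem HasPolyFreeChain.extend {n : ℕ} [IsFreeGroup H] (g : G →* H)
    (h : HasPolyFreeChain g.ker n) : HasPolyFreeChain G (n + 1) := by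
  obtain ⟨C, h0, h1, hC⟩ := h
  refine ⟨Fin.snoc (fun i => (C i).map g.ker.subtype) ⊤, ?_, by simp, fun i => ?_⟩
  · rw [← Fin.castSucc_zero, Fin.snoc_castSucc, h0, Subgroup.map_bot]
  · change HasFreeQuotient _ _
    induction i using Fin.lastCases with
    | last =>
      rw [Fin.succ_last, Fin.snoc_last, Fin.snoc_castSucc, h1]
      exact HasFreeQuotient.of_hom le_top (g.comp (⊤ : Subgroup G).subtype) fun b => by
        simp
    | cast i =>
      rw [Fin.succ_castSucc, Fin.snoc_castSucc, Fin.snoc_castSucc]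
      exact (show HasFreeQuotient _ _ from hC i).map _ g.ker.subtype_injective

/-- The first conjunct excludes the default value `sInf ∅ = 0`. -/
theorem isPolyFree_and_length_le_iff {n : ℕ} :
    IsPolyFree G ∧ polyFreeLength G ≤ n ↔ HasPolyFreeChain G n :=
  ⟨fun ⟨h, hn⟩ => HasPolyFreeChain.mono (Nat.sInf_mem h) hn, fun h => ⟨⟨n, h⟩, Nat.sInf_le h⟩⟩

theorem isNormallyPolyFree_and_length_le_iff {n : ℕ} :
    IsNormallyPolyFree G ∧ normallyPolyFreeLength G ≤ n ↔ HasNormalPolyFreeChain G n :=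
  ⟨fun ⟨h, hn⟩ => HasNormalPolyFreeChain.mono (Nat.sInf_mem h) hn,
    fun h => ⟨⟨n, h⟩, Nat.sInf_le h⟩⟩

end FreeQuotients

/-! ### Embedding the kernel of a map out of a free product -/

section Embedding

open Monoid

variable {I : Type u} {G : I → Type v} [∀ i, Group (G i)] {X : Type w} [Group X]

/-- The groups `N i` together with a free group on `Y`, as one family. -/
def withFreeGroup (N : I → Type v) (Y : Type w) : Option I → Type (max v w)
  | none => ULift (FreeGroup Y)
  | some i => ULift (N i)

instance (N : I → Type v) [∀ i, Group (N i)] (Y : Type w) :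
    ∀ o, Group (withFreeGroup N Y o)
  | none => inferInstanceAs (Group (ULift (FreeGroup Y)))
  | some i => inferInstanceAs (Group (ULift (N i)))

/-- The inclusion of a member of the original family. -/
def withFreeGroup.inl (N : I → Type v) [∀ i, Group (N i)] (Y : Type w) (i : I) :
    N i →* CoprodI (withFreeGroup N Y) :=
  (CoprodI.of (M := withFreeGroup N Y) (i := some i)).comp
    (MulEquiv.ulift.symm : N i ≃* ULift (N i)).toMonoidHom

/-- The inclusion of the free group. -/
def withFreeGroup.inr (N : I → Type v) [∀ i, Group (N i)] (Y : Type w) :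
    FreeGroup Y →* CoprodI (withFreeGroup N Y) :=
  (CoprodI.of (M := withFreeGroup N Y) (i := none)).comp
    (MulEquiv.ulift.symm : FreeGroup Y ≃* ULift (FreeGroup Y)).toMonoidHom

/-- The universal property of the free product of the `N i` and a free group. -/
theorem withFreeGroup.exists_lift (N : I → Type v) [∀ i, Group (N i)] (Y : Type w)
    {P : Type*} [Group P] (f : ∀ i, N i →* P) (g : Y → P) :
    ∃ φ : CoprodI (withFreeGroup N Y) →* P,
      (∀ i a, φ (inl N Y i a) = f i a) ∧ ∀ y, φ (inr N Y (FreeGroup.of y)) = g y := by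
  let F : ∀ o, withFreeGroup N Y o →* P
    | none => (FreeGroup.lift g).comp
        (MulEquiv.ulift : ULift (FreeGroup Y) ≃* FreeGroup Y).toMonoidHom
    | some i => (f i).comp (MulEquiv.ulift : ULift (N i) ≃* N i).toMonoidHom
  refine ⟨CoprodI.lift F, fun i a => ?_, fun y => ?_⟩
  · exact CoprodI.lift_of F (i := some i) _
  · exact (CoprodI.lift_of F (i := none) _).trans FreeGroup.lift_apply_of

/-- A choice, for every point of a group `X` acted on by `A` through a homomorphism, of an element
of `A` carrying the representative of the orbit to that point, up to the kernel. -/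
theorem MonoidHom.exists_orbit_section {A : Type*} [Group A] (θ : A →* X) :
    ∃ r : X → A, ∀ a x, θ (r (θ a * x)) = θ a * θ (r x) := by
  let s := QuotientGroup.rightRel θ.range
  let t : X → X := fun x => (Quotient.mk s x).out
  have ht : ∀ x, ∃ a, θ a * t x = x := fun x => by
    have h : s (Quotient.mk s x).out x := Quotient.mk_out (s := s) x
    obtain ⟨a, ha⟩ := QuotientGroup.rightRel_apply.1 h
    exact ⟨a, by rw [ha]; simp [t]⟩
  choose r hr using ht
  refine ⟨r, fun a x => ?_⟩
  have hx : t (θ a * x) = t x := by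
    have h : Quotient.mk s (θ a * x) = Quotient.mk s x :=
      Quotient.sound (QuotientGroup.rightRel_apply.2 ⟨a⁻¹, by simp⟩)
    simp only [t, h]
  have h1 := hr (θ a * x)
  rw [hx] at h1
  rw [← mul_left_inj (t x), h1, mul_assoc, hr]

/-- The kernel of a homomorphism from a free product embeds in the free product of the kernels on
the factors and a free group. -/
theorem CoprodI.exists_injective_ker_lift (θ : ∀ i, G i →* X) :
    ∃ f : (CoprodI.lift θ).ker →*
      CoprodI (withFreeGroup (fun i => (θ i).ker) (X × I)), Function.Injective f := by
  set Θ := CoprodI.lift θ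
  let ι := withFreeGroup.inl (fun i => (θ i).ker) (X × I)
  let e : X → I → CoprodI (withFreeGroup (fun i => (θ i).ker) (X × I)) := fun x i =>
    withFreeGroup.inr (fun i => (θ i).ker) (X × I) (FreeGroup.of (x, i))
  choose r hr using fun i => (θ i).exists_orbit_section
  let d : ∀ i, G i → X → (θ i).ker := fun i a x =>
    ⟨(r i (θ i a * x))⁻¹ * a * r i x, by simp [MonoidHom.mem_ker, hr]⟩
  -- A cocycle for the action of `G i` on `X`: the element `a` with each `r i x` replaced by a free
  -- letter. Conjugation by these letters lets one copy of each kernel serve all orbits.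
  let c : ∀ i, G i → X → CoprodI (withFreeGroup (fun i => (θ i).ker) (X × I)) := fun i a x => (e (θ i a * x) i)⁻¹ * ι i (d i a x) * e x i
  have c_one : ∀ i x, c i 1 x = 1 := fun i x => by
    have : d i 1 x = 1 := by ext; simp [d]
    simp [c, this]
  have c_mul : ∀ i a b x, c i (a * b) x = c i a (θ i b * x) * c i b x := fun i a b x => by
    have : d i (a * b) x = d i a (θ i b * x) * d i b x := by
      ext
      simp [d, mul_assoc]
    simp [c, this, mul_assoc]
  -- Encoding the cocycles as skew actions lets the universal property glue them into one cocycle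
  -- `F` on the free product.
  let Φ : CoprodI G →* Function.End (X × CoprodI (withFreeGroup (fun i => (θ i).ker) (X × I))) := CoprodI.lift fun i =>
    { toFun := fun a p => (θ i a * p.1, c i a p.1 * p.2)
      map_one' := by
        funext p
        simp [c_one]
        rfl
      map_mul' := fun a b => by
        funext p
        simp [c_mul, mul_assoc]
        rfl }
  have Φ_of : ∀ i (a : G i) p, Φ (CoprodI.of a) p = (θ i a * p.1, c i a p.1 * p.2) :=
    fun i a p => by simp only [Φ, CoprodI.lift_of]; rfl
  have Φ_one : ∀ p, Φ 1 p = p := fun p => by rw [map_one]; rfl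
  have Φ_mul : ∀ a b p, Φ (a * b) p = Φ a (Φ b p) := fun a b p => by rw [map_mul]; rfl
  have Φ_apply : ∀ a x p, Φ a (x, p) = (Θ a * x, (Φ a (x, 1)).2 * p) := fun a => by
    induction a using CoprodI.induction_on with
    | one => intro x p; simp [Φ_one]
    | of i a => intro x p; simp [Φ_of, Θ]
    | mul a b ha hb =>
      intro x p
      rw [Φ_mul, Φ_mul, hb x p, hb x 1, ha, ha _ (_ * 1), map_mul]
      simp only [mul_assoc, mul_one]
  let F : CoprodI G → X → CoprodI (withFreeGroup (fun i => (θ i).ker) (X × I)) := fun a x => (Φ a (x, 1)).2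
  have F_mul : ∀ a b x, F (a * b) x = F a (Θ b * x) * F b x := fun a b x => by
    simp only [F]
    rw [Φ_mul, Φ_apply b, Φ_apply a, mul_one]
  -- Sending the letters back to `(r i x)⁻¹` undoes the substitution, so `Ψ` is a left inverse of `F
  -- · x` for every `x`.
  obtain ⟨Ψ, Ψ_inl, Ψ_inr⟩ := withFreeGroup.exists_lift (fun i => (θ i).ker) (X × I)
    (fun i => (CoprodI.of (M := G) (i := i)).comp (θ i).ker.subtype)
    (fun y => (CoprodI.of (r y.2 y.1))⁻¹)
  have Ψ_F : ∀ a x, Ψ (F a x) = a := fun a => by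
    induction a using CoprodI.induction_on with
    | one => intro x; simp [F, Φ_one]
    | of i a =>
      intro x
      simp only [F, Φ_of, c, ι, e, d, mul_one, map_mul, map_inv, Ψ_inl, Ψ_inr]
      simp [mul_assoc]
    | mul a b ha hb =>
      intro x
      rw [F_mul, map_mul, ha, hb]
  -- The kernel of `Θ` fixes the base point `1`, so there the cocycle is a homomorphism.
  refine ⟨⟨⟨fun a => F a 1, ?_⟩, fun a b => ?_⟩, fun a b h => ?_⟩
  · simp [F, Φ_one]
  · have hb : Θ b = 1 := b.2
    change F (a * b) 1 = _
    rw [F_mul, hb, mul_one]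
  · have h' : Ψ (F a 1) = Ψ (F b 1) := congrArg Ψ h
    rw [Ψ_F, Ψ_F] at h'
    exact Subtype.ext h'

end Embedding

/-! ### Chains in free products -/

section FreeProducts

open Monoid

/-- The homomorphism of free products induced by the projections to quotients of the factors. -/
def CoprodI.mapQuotient {I : Type u} {G : I → Type v} [∀ i, Group (G i)]
    (A : ∀ i, Subgroup (G i)) [∀ i, (A i).Normal] :
    CoprodI G →* CoprodI fun i => G i ⧸ A i :=
  CoprodI.lift fun i => CoprodI.of.comp (QuotientGroup.mk' (A i))

theorem CoprodI.mapQuotient_of {I : Type u} {G : I → Type v} [∀ i, Group (G i)]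
    (A : ∀ i, Subgroup (G i)) [∀ i, (A i).Normal] (i : I) (a : G i) :
    CoprodI.mapQuotient A (CoprodI.of a) =
      CoprodI.of (M := fun i => G i ⧸ A i) (a : G i ⧸ A i) :=
  CoprodI.lift_of _ a

theorem CoprodI.subsingleton {I : Type u} {G : I → Type v} [∀ i, Group (G i)]
    [∀ i, Subsingleton (G i)] : Subsingleton (CoprodI G) := by
  refine subsingleton_of_forall_eq 1 fun a => ?_
  induction a using CoprodI.induction_on with
  | one => rfl
  | of i a => rw [Subsingleton.elim a 1, map_one]
  | mul a b ha hb => rw [ha, hb, mul_one]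

theorem CoprodI.lift_injective_of_leftInverse {I : Type u} {G : I → Type v} {G' : I → Type w}
    [∀ i, Group (G i)] [∀ i, Group (G' i)] (f : ∀ i, G i →* G' i) (g : ∀ i, G' i →* G i)
    (hfg : ∀ i a, g i (f i a) = a) :
    Function.Injective (CoprodI.lift fun i => (CoprodI.of (M := G') (i := i)).comp (f i)) := by
  refine Function.LeftInverse.injective
    (g := CoprodI.lift fun i => (CoprodI.of (M := G) (i := i)).comp (g i)) fun a => ?_
  induction a using CoprodI.induction_on with
  | one => simp
  | of i a => simp [hfg]
  | mul a b ha hb => rw [map_mul, map_mul, ha, hb]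

theorem isFreeGroup_withFreeGroup {I : Type u} (N : I → Type v) [∀ i, Group (N i)] (Y : Type w)
    (h : ∀ i, IsFreeGroup (N i)) : ∀ o, IsFreeGroup (withFreeGroup N Y o)
  | none => IsFreeGroup.ofMulEquiv (MulEquiv.ulift : ULift (FreeGroup Y) ≃* FreeGroup Y).symm
  | some i => IsFreeGroup.ofMulEquiv (MulEquiv.ulift : ULift (N i) ≃* N i).symm

/-- The length is `n + 1` because the added free factor may need one step. -/
theorem hasPolyFreeChain_withFreeGroup {I : Type u} (N : I → Type v) [∀ i, Group (N i)]
    (Y : Type w) {n : ℕ} (h : ∀ i, HasPolyFreeChain (N i) (n + 1)) :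
    ∀ o, HasPolyFreeChain (withFreeGroup N Y o) (n + 1)
  | none => (IsFreeGroup.hasNormalPolyFreeChain_one.hasPolyFreeChain.mono
      (Nat.le_add_left 1 n)).of_injective
        (MulEquiv.ulift : ULift (FreeGroup Y) ≃* FreeGroup Y).toMonoidHom MulEquiv.ulift.injective
  | some i => (h i).of_injective
      (MulEquiv.ulift : ULift (N i) ≃* N i).toMonoidHom MulEquiv.ulift.injective

theorem hasNormalPolyFreeChain_withFreeGroup {I : Type u} (N : I → Type v) [∀ i, Group (N i)]
    (Y : Type w) {n : ℕ} (h : ∀ i, HasNormalPolyFreeChain (N i) (n + 1)) :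
    ∀ o, HasNormalPolyFreeChain (withFreeGroup N Y o) (n + 1)
  | none => (IsFreeGroup.hasNormalPolyFreeChain_one.mono
      (Nat.le_add_left 1 n)).of_injective
        (MulEquiv.ulift : ULift (FreeGroup Y) ≃* FreeGroup Y).toMonoidHom MulEquiv.ulift.injective
  | some i => (h i).of_injective
      (MulEquiv.ulift : ULift (N i) ≃* N i).toMonoidHom MulEquiv.ulift.injective

/-- The induction starts at length one, since the kernels acquire a free factor. It changes the
family, and the universe `max u v` is stable under this change. -/
theorem hasPolyFreeChain_coprodI_succ (n : ℕ) :
    ∀ {I : Type u} {G : I → Type (max u v)} [∀ i, Group (G i)],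
      (∀ i, HasPolyFreeChain (G i) (n + 1)) → HasPolyFreeChain (CoprodI G) (n + 1) := by
  induction n with
  | zero =>
    intro I G _ h
    have : ∀ i, IsFreeGroup (G i) := fun i => by
      obtain ⟨N, hN, hF, hn⟩ := (h i).exists_normal
      have := hasPolyFreeChain_zero_iff.1 hn
      refine IsFreeGroup.of_injective (QuotientGroup.mk' N) ((MonoidHom.ker_eq_bot_iff _).1 ?_)
      rw [QuotientGroup.ker_mk', Subgroup.eq_bot_of_subsingleton N]
    exact IsFreeGroup.hasNormalPolyFreeChain_one.hasPolyFreeChain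
  | succ n ih =>
    intro I G _ h
    choose N hN hF hn using fun i => (h i).exists_normal
    refine HasPolyFreeChain.extend (CoprodI.mapQuotient N) ?_
    obtain ⟨f, hf⟩ := CoprodI.exists_injective_ker_lift fun i =>
      (CoprodI.of (M := fun i => G i ⧸ N i) (i := i)).comp (QuotientGroup.mk' (N i))
    refine HasPolyFreeChain.of_injective (ih (hasPolyFreeChain_withFreeGroup _ _ fun i => ?_)) f hf
    refine (hn i).of_injective (Subgroup.inclusion ?_) (Subgroup.inclusion_injective _)
    intro a ha
    rw [MonoidHom.mem_ker, MonoidHom.comp_apply] at ha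
    exact (QuotientGroup.eq_one_iff a).1 (CoprodI.of_injective i (ha.trans (map_one _).symm))

theorem hasPolyFreeChain_coprodI {I : Type u} {G : I → Type v} [∀ i, Group (G i)] {n : ℕ}
    (h : ∀ i, HasPolyFreeChain (G i) n) : HasPolyFreeChain (CoprodI G) n := by
  cases n with
  | zero =>
    have : ∀ i, Subsingleton (G i) := fun i => hasPolyFreeChain_zero_iff.1 (h i)
    exact hasPolyFreeChain_zero_iff.2 CoprodI.subsingleton
  | succ n =>
    refine HasPolyFreeChain.of_injective (hasPolyFreeChain_coprodI_succ.{u, v} n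
      (G := fun i => ULift.{u} (G i)) fun i => (h i).of_injective
        (MulEquiv.ulift : ULift (G i) ≃* G i).toMonoidHom MulEquiv.ulift.injective) _
      (CoprodI.lift_injective_of_leftInverse (G' := fun i => ULift.{u} (G i))
        (fun i => (MulEquiv.ulift : ULift (G i) ≃* G i).symm.toMonoidHom)
        (fun i => (MulEquiv.ulift : ULift (G i) ≃* G i).toMonoidHom) fun i a => rfl)

/-- The quotient is carried into the kernel of `∗ (G i ⧸ A i) → ∗ (G i ⧸ B i)`, which embeds in a
free product of the free groups `B i / A i` and a free group. -/
theorem HasFreeQuotient.ker_mapQuotient {I : Type u} {G : I → Type v} [∀ i, Group (G i)]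
    (A B : ∀ i, Subgroup (G i)) [∀ i, (A i).Normal] [∀ i, (B i).Normal]
    (h : ∀ i, HasFreeQuotient (A i) (B i)) :
    HasFreeQuotient (CoprodI.mapQuotient A).ker (CoprodI.mapQuotient B).ker := by
  let p : ∀ i, G i ⧸ A i →* G i ⧸ B i := fun i =>
    QuotientGroup.map (A i) (B i) (MonoidHom.id _) (h i).1
  let θ : ∀ i, G i ⧸ A i →* CoprodI fun i => G i ⧸ B i := fun i =>
    (CoprodI.of (M := fun i => G i ⧸ B i) (i := i)).comp (p i)
  have hθ : ∀ i (a : G i), (a : G i ⧸ A i) ∈ (θ i).ker ↔ a ∈ B i := fun i a => by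
    rw [MonoidHom.mem_ker, MonoidHom.comp_apply, ← QuotientGroup.eq_one_iff]
    exact map_eq_one_iff _ (CoprodI.of_injective i)
  have hcomp : ∀ a, CoprodI.lift θ (CoprodI.mapQuotient A a) = CoprodI.mapQuotient B a :=
      fun a => by
    induction a using CoprodI.induction_on with
    | one => simp
    | of i a => rw [CoprodI.mapQuotient_of, CoprodI.mapQuotient_of, CoprodI.lift_of]; rfl
    | mul a b ha hb => rw [map_mul, map_mul, map_mul, ha, hb]
  have hfree : ∀ i, IsFreeGroup (θ i).ker := fun i => by
    obtain ⟨hle, hn, hF⟩ := h i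
    let q : B i →* (θ i).ker :=
      ((QuotientGroup.mk' (A i)).comp (B i).subtype).codRestrict _ fun b => (hθ i b).2 b.2
    have hq : (A i).subgroupOf (B i) = q.ker := by
      ext b
      rw [Subgroup.mem_subgroupOf, MonoidHom.mem_ker, ← QuotientGroup.eq_one_iff, Subtype.ext_iff]
      rfl
    -- The kernel of `θ i` is the image of `B i` in `G i ⧸ A i`, that is, `B i / A i`.
    refine IsFreeGroup.ofMulEquiv (MulEquiv.ofBijective (QuotientGroup.lift _ q hq.le)
      ⟨(QuotientGroup.injective_lift_iff _ _ _).2 hq, ?_⟩)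
    rintro ⟨x, hx⟩
    obtain ⟨a, rfl⟩ := QuotientGroup.mk_surjective x
    exact ⟨((⟨a, (hθ i a).1 hx⟩ : B i) : B i ⧸ _), rfl⟩
  obtain ⟨f, hf⟩ := CoprodI.exists_injective_ker_lift θ
  have := isFreeGroup_withFreeGroup (fun i => (θ i).ker) ((CoprodI fun i => G i ⧸ B i) × I) hfree
  refine HasFreeQuotient.of_hom (fun a ha => ?_)
    (f.comp (((CoprodI.mapQuotient A).comp (Subgroup.subtype _)).codRestrict _ fun b => ?_))
    fun b => ?_
  · rw [MonoidHom.mem_ker] at ha ⊢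
    rw [← hcomp, ha, map_one]
  · exact (hcomp b).trans b.2
  · rw [MonoidHom.comp_apply, ← map_one f, hf.eq_iff, Subtype.ext_iff]
    rfl

theorem hasNormalPolyFreeChain_coprodI {I : Type u} {G : I → Type v} [∀ i, Group (G i)] {n : ℕ}
    (h : ∀ i, HasNormalPolyFreeChain (G i) n) : HasNormalPolyFreeChain (CoprodI G) n := by
  choose C hC hN using h
  refine ⟨fun k => (CoprodI.mapQuotient fun i => C i k).ker, ⟨?_, ?_, fun k => ?_⟩,
    fun k => inferInstance⟩
  · rw [MonoidHom.ker_eq_bot_iff]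
    exact CoprodI.lift_injective_of_leftInverse (G' := fun i => G i ⧸ C i 0) _
      (fun i => QuotientGroup.lift _ (MonoidHom.id _) fun a ha => by
        rwa [(hC i).1, Subgroup.mem_bot] at ha) fun i a => rfl
  · have : ∀ i, Subsingleton (G i ⧸ C i (Fin.last n)) := fun i =>
      QuotientGroup.subsingleton_iff.2 (hC i).2.1
    have := CoprodI.subsingleton (G := fun i => G i ⧸ C i (Fin.last n))
    exact eq_top_iff.2 fun a _ => Subsingleton.elim _ _
  · exact HasFreeQuotient.ker_mapQuotient _ _ fun i => (hC i).2.2 k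

/-- For finite index normal subgroups of finitely many groups, some finite index subgroup of the
free product embeds in the free product of these subgroups and a free group. -/
theorem CoprodI.exists_finiteIndex_embedding {I : Type u} [Finite I] {G : I → Type v}
    [∀ i, Group (G i)] (N : ∀ i, Subgroup (G i)) [∀ i, (N i).Normal] [∀ i, (N i).FiniteIndex] :
    ∃ D : Subgroup (CoprodI G), D.FiniteIndex ∧ ∃ f : D →*
      CoprodI (withFreeGroup (fun i => N i) ((∀ i, G i ⧸ N i) × I)), Function.Injective f := by
  classical
  let θ : ∀ i, G i →* ∀ i, G i ⧸ N i := fun i =>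
    (MonoidHom.mulSingle (fun i => G i ⧸ N i) i).comp (QuotientGroup.mk' (N i))
  have hθ : N = fun i => (θ i).ker := by
    funext i
    ext a
    rw [MonoidHom.mem_ker, MonoidHom.comp_apply, MonoidHom.mulSingle_apply, Pi.mulSingle_eq_one_iff]
    exact (QuotientGroup.eq_one_iff a).symm
  have hf := CoprodI.exists_injective_ker_lift θ
  refine ⟨(CoprodI.lift θ).ker, inferInstance, ?_⟩
  -- `N` also occurs in `θ` and in the letters of the free group; a separate `M` allows substitution
  -- in the factors alone.
  have key : ∀ M : ∀ i, Subgroup (G i), M = (fun i => (θ i).ker) →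
      ∃ f : (CoprodI.lift θ).ker →*
        CoprodI (withFreeGroup (fun i => M i) ((∀ i, G i ⧸ N i) × I)), Function.Injective f := by
    rintro M rfl
    exact hf
  exact key N hθ

theorem isVirtuallyPolyFree_coprodI {I : Type u} [Finite I] {G : I → Type v} [∀ i, Group (G i)]
    (h : ∀ i, IsVirtuallyPolyFree (G i)) : IsVirtuallyPolyFree (CoprodI G) := by
  choose K hK n hn using h
  -- Finiteness of `I` gives a common length bound here, and a finite target group in the embedding
  -- below.
  obtain ⟨m, hm⟩ := (Set.finite_range n).bddAbove
  obtain ⟨D, hD, f, hf⟩ := CoprodI.exists_finiteIndex_embedding fun i => (K i).normalCore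
  refine ⟨D, hD, m + 1, HasPolyFreeChain.of_injective
    (hasPolyFreeChain_coprodI (hasPolyFreeChain_withFreeGroup _ _ fun i => ?_)) f hf⟩
  exact ((hn i).mono ((hm ⟨i, rfl⟩).trans m.le_succ)).of_injective
    (Subgroup.inclusion (K i).normalCore_le) (Subgroup.inclusion_injective _)

theorem isVirtuallyNormallyPolyFree_coprodI {I : Type u} [Finite I] {G : I → Type v}
    [∀ i, Group (G i)] (h : ∀ i, IsVirtuallyNormallyPolyFree (G i)) :
    IsVirtuallyNormallyPolyFree (CoprodI G) := by
  choose K hK n hn using h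
  obtain ⟨m, hm⟩ := (Set.finite_range n).bddAbove
  obtain ⟨D, hD, f, hf⟩ := CoprodI.exists_finiteIndex_embedding fun i => (K i).normalCore
  refine ⟨D, hD, m + 1, HasNormalPolyFreeChain.of_injective
    (hasNormalPolyFreeChain_coprodI (hasNormalPolyFreeChain_withFreeGroup _ _ fun i => ?_)) f hf⟩
  exact ((hn i).mono ((hm ⟨i, rfl⟩).trans m.le_succ)).of_injective
    (Subgroup.inclusion (K i).normalCore_le) (Subgroup.inclusion_injective _)

end FreeProducts

theorem mainTheorem6 {I : Type*} (G : I → Type*) [∀ i, Group (G i)] :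
    (∀ n : ℕ, (∀ i, IsPolyFree (G i) ∧ polyFreeLength (G i) ≤ n) →
      IsPolyFree (Monoid.CoprodI G) ∧ polyFreeLength (Monoid.CoprodI G) ≤ n) ∧
    (∀ n : ℕ, (∀ i, IsNormallyPolyFree (G i) ∧ normallyPolyFreeLength (G i) ≤ n) →
      IsNormallyPolyFree (Monoid.CoprodI G) ∧
        normallyPolyFreeLength (Monoid.CoprodI G) ≤ n) ∧
    (Finite I → (∀ i, IsVirtuallyPolyFree (G i)) →
      IsVirtuallyPolyFree (Monoid.CoprodI G)) ∧
    (Finite I → (∀ i, IsVirtuallyNormallyPolyFree (G i)) →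
      IsVirtuallyNormallyPolyFree (Monoid.CoprodI G)) := by
  refine ⟨fun n h => isPolyFree_and_length_le_iff.2 (hasPolyFreeChain_coprodI fun i =>
      isPolyFree_and_length_le_iff.1 (h i)),
    fun n h => isNormallyPolyFree_and_length_le_iff.2 (hasNormalPolyFreeChain_coprodI fun i =>
      isNormallyPolyFree_and_length_le_iff.1 (h i)),
    fun _ h => isVirtuallyPolyFree_coprodI h, fun _ h => isVirtuallyNormallyPolyFree_coprodI h⟩
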